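/- **Conventions.** A represented space $\mathbf X=(X,\delta_X)$ is a set $X$ with a partial surjection $\delta_X:\subseteq\{0,1\}^{\mathbb N}\to X$; $p$ is a name of $x$ if $\delta_X(p)=x$. A (possibly partial) map between represented spaces is computable if some machine transforms every name of every point $x$ of its domain into a name of the value at $x$. The points of $\mathbf X\times\mathbf Y$ are named by pairs $\langle p,q\rangle$. $\mathcal C(\mathbf X,\mathbf Y)$ is the space of the functions $f:X\to Y$ that have a realizer computable relative to some oracle, $0^n1o$ being a name of $f$ if the $n$-th machine with oracle $o$ computes a realizer of $f$. The Sierpiński space $\mathbb S=\{\bot,\top\}$ has $0^{\mathbb N}$ as the only name of $\bot$, and all other sequences as names of $\top$. $\mathcal O(\mathbf X)$ (open sets) and $\mathcal A(\mathbf X)$ (closed sets) are obtained from $\mathcal C(\mathbf X,\mathbb S)$ by identifying $f$ with $f^{-1}(\{\top\})$, respectively with $f^{-1}(\{\bot\})$. The saturation $\overbrace{K}$ of $K\subseteq X$ is the intersection of all $U\in\mathcal O(\mathbf X)$ with $K\subseteq U$; $K$ is saturated if $K=\overbrace{K}$, and compact if $\{U\in\mathcal O(\mathbf X)\mid K\subseteq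 U\}\in\mathcal O(\mathcal O(\mathbf X))$. $\mathcal K(\mathbf X)$ is the space of saturated compact sets, as a subspace of $\mathcal O(\mathcal O(\mathbf X))$ via $K\mapsto\{U\in\mathcal O(\mathbf X)\mid K\subseteq U\}$. **Proposition.** For all represented spaces $\mathbf X$, $\mathbf Y$ the following operations are well-defined and computable: 1. $\operatorname{ContainedIn}:\mathcal K(\mathbf X)\times\mathcal O(\mathbf X)\to\mathbb S$, with $\operatorname{ContainedIn}(K,U)=\top$ iff $K\subseteq U$; 2. $x\mapsto\overbrace{\{x\}}:\mathbf X\to\mathcal K(\mathbf X)$; 3. $(K,L)\mapsto K\cup L:\mathcal K(\mathbf X)\times\mathcal K(\mathbf X)\to\mathcal K(\mathbf X)$; 4. $(K,A)\mapsto\overbrace{K\cap A}:\mathcal K(\mathbf X)\times\mathcal A(\mathbf X)\to\mathcal K(\mathbf X)$; 5. the partial map $:\subseteq\mathcal C(\mathcal O(\mathbf Y),\mathcal O(\mathbf X))\to\mathcal C(\mathcal K(\mathbf X),\mathcal K(\mathbf Y))$ whose domain consists of the maps of the form $U\mapsto f^{-1}(U)$ for some function $f:X\to Y$, and which sends such a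 map to $K\mapsto\overbrace{f[K]}$ (in particular, the latter depends only on $f^{-1}$); 6. $f\mapsto\bigl(K\mapsto\overbrace{f[K]}\bigr):\mathcal C(\mathbf X,\mathbf Y)\to\mathcal C(\mathcal K(\mathbf X),\mathcal K(\mathbf Y))$; 7. $(f,K)\mapsto\overbrace{f[K]}:\mathcal C(\mathbf X,\mathbf Y)\times\mathcal K(\mathbf X)\to\mathcal K(\mathbf Y)$; 8. $(K,L)\mapsto K\times L:\mathcal K(\mathbf X)\times\mathcal K(\mathbf Y)\to\mathcal K(\mathbf X\times\mathbf Y)$; 9. the projections $K\mapsto\pi_1[K]:\mathcal K(\mathbf X\times\mathbf Y)\to\mathcal K(\mathbf X)$ and $K\mapsto\pi_2[K]:\mathcal K(\mathbf X\times\mathbf Y)\to\mathcal K(\mathbf Y)$. -/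

import Mathlib

universe u v

noncomputable section

/-- Cantor space `{0,1}^ℕ`. -/
abbrev Cantor : Type := ℕ → Bool

namespace Cantor

/-- The finite prefix `p(0) … p(k-1)`. -/
def take (p : Cantor) (k : ℕ) : List Bool := (List.range k).map p

/-- The pairing `⟨p, q⟩ = p(0) q(0) p(1) q(1) …`. -/
def pair (p q : Cantor) : Cantor := fun i => if i % 2 = 0 then p (i / 2) else q (i / 2)

/-- The first component of `⟨p, q⟩`. -/
def fst (p : Cantor) : Cantor := fun i => p (2 * i)

/-- The second component of `⟨p, q⟩`. -/
def snd (p : Cantor) : Cantor := fun i => p (2 * i + 1)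

/-- The sequence `0ⁿ 1 p`. -/
def tag (n : ℕ) (p : Cantor) : Cantor := fun i =>
  if i < n then false else if i = n then true else p (i - (n + 1))

@[simp] theorem fst_pair (p q : Cantor) : fst (pair p q) = p := by
  funext i; simp [fst, pair]

@[simp] theorem snd_pair (p q : Cantor) : snd (pair p q) = q := by
  funext i
  have h1 : (2 * i + 1) % 2 = 1 := by omega
  have h2 : (2 * i + 1) / 2 = i := by omega
  simp [snd, pair, h1, h2]

theorem tag_injective {m n : ℕ} {p q : Cantor} (h : tag m p = tag n q) : m = n ∧ p = q := by
  have hmn : m = n := by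
    rcases lt_trichotomy m n with hlt | heq | hgt
    · have := congrFun h m
      simp [tag, hlt] at this
    · exact heq
    · have := congrFun h n
      simp [tag, hgt] at this
  subst hmn
  refine ⟨rfl, funext fun i => ?_⟩
  have := congrFun h (i + (m + 1))
  have h1 : ¬ (i + (m + 1) < m) := by omega
  have h2 : ¬ (i + (m + 1) = m) := by omega
  simpa [tag, h1, h2] using this

end Cantor

/-! ### Machines on infinite sequences

A program is a code `c` for a partial recursive function.  Running it on the infinite tape `p` in
order to obtain the output symbol number `n` means: search, over all pairs of a prefix length `k`
and a time bound `t`, for a pair such that `c` halts within time `t` on the finite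
prefix of `p` of length `k` (and `n`); the result of the first successful attempt is the output.
Thus every output symbol is computed from finitely many symbols of the tape.  A machine
with oracle `o` and input `p` has the tape `⟨o, p⟩`. -/

/-- The result (if any) of the program `c` for output position `n`, on tape `p`. -/
def machineRun (c : Nat.Partrec.Code) (p : Cantor) (n : ℕ) : Part ℕ :=
  Nat.rfindOpt fun s =>
    Nat.Partrec.Code.evaln s.unpair.2 c (Encodable.encode (p.take s.unpair.1, n))

/-- The program `c` writes the infinite sequence `q` when run on the tape `p`. -/
def MachineComputes (c : Nat.Partrec.Code) (p q : Cantor) : Prop :=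
  ∀ n, Encodable.encode (q n) ∈ machineRun c p n

theorem MachineComputes.unique {c : Nat.Partrec.Code} {p q q' : Cantor}
    (h : MachineComputes c p q) (h' : MachineComputes c p q') : q = q' :=
  funext fun n => Encodable.encode_injective (Part.mem_unique (h n) (h' n))

/-- The `n`-th program in the standard numbering. -/
def nthMachine (n : ℕ) : Nat.Partrec.Code := Denumerable.ofNat Nat.Partrec.Code n

/-- A represented space: a set together with a partial surjection from Cantor space onto it,
given by its graph, `Names p x` meaning `δ(p) = x`. -/
structure RepSpace : Type (u + 1) where
  carrier : Type u
  Names : Cantor → carrier → Prop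
  unique : ∀ {p x y}, Names p x → Names p y → x = y
  surj : ∀ x, ∃ p, Names p x

namespace RepSpace

instance : CoeSort RepSpace.{u} (Type u) := ⟨RepSpace.carrier⟩

/-- The partial function `p ↦ q` on Cantor space whose graph is `G` is a realizer of `f`. -/
def Realizes (X : RepSpace.{u}) (Y : RepSpace.{v}) (G : Cantor → Cantor → Prop) (f : X → Y) :
    Prop :=
  ∀ p x, X.Names p x → ∃ q, G p q ∧ Y.Names q (f x)

/-- A map between represented spaces is computable if some machine computes a realizer of it. -/
def IsComputable (X : RepSpace.{u}) (Y : RepSpace.{v}) (f : X → Y) : Prop :=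
  ∃ c, Realizes X Y (MachineComputes c) f

/-- `r` is a name of the function `f`: `r = 0ⁿ 1 o`, where the `n`-th machine with oracle `o`
computes a realizer of `f`. -/
def IsFunName (X : RepSpace.{u}) (Y : RepSpace.{v}) (r : Cantor) (f : X → Y) : Prop :=
  ∃ n o, r = Cantor.tag n o ∧
    Realizes X Y (fun p q => MachineComputes (nthMachine n) (Cantor.pair o p) q) f

theorem IsFunName.unique {X : RepSpace.{u}} {Y : RepSpace.{v}} {r : Cantor} {f g : X → Y}
    (hf : IsFunName X Y r f) (hg : IsFunName X Y r g) : f = g := by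
  obtain ⟨n, o, rfl, hf⟩ := hf
  obtain ⟨n', o', h, hg⟩ := hg
  obtain ⟨rfl, rfl⟩ := Cantor.tag_injective h
  funext x
  obtain ⟨p, hp⟩ := X.surj x
  obtain ⟨q, hq, hy⟩ := hf p x hp
  obtain ⟨q', hq', hy'⟩ := hg p x hp
  obtain rfl := hq.unique hq'
  exact Y.unique hy hy'

/-- The space `𝒞(X, Y)` of functions that are continuous (computable relative to an oracle). -/
def maps (X : RepSpace.{u}) (Y : RepSpace.{v}) : RepSpace.{max u v} where
  carrier := {f : X → Y // ∃ r, IsFunName X Y r f}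
  Names r f := IsFunName X Y r f.1
  unique h h' := Subtype.ext (h.unique h')
  surj f := f.2

/-- The Sierpiński space, with `⊥ = False`, `⊤ = True`: the name of `⊥` is `0^ℕ`, every other
sequence is a name of `⊤`. -/
def sierp : RepSpace.{0} where
  carrier := Prop
  Names p s := s ↔ ∃ n, p n = true
  unique h h' := propext (h.trans h'.symm)
  surj s := by
    classical
    exact ⟨fun _ => decide s, by simp⟩

/-- The product space, with names `⟨p, q⟩`. -/
def prod (X : RepSpace.{u}) (Y : RepSpace.{v}) : RepSpace.{max u v} where
  carrier := X × Y
  Names r z := X.Names r.fst z.1 ∧ Y.Names r.snd z.2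
  unique h h' := Prod.ext (X.unique h.1 h'.1) (Y.unique h.2 h'.2)
  surj z := by
    obtain ⟨p, hp⟩ := X.surj z.1
    obtain ⟨q, hq⟩ := Y.surj z.2
    exact ⟨Cantor.pair p q, by simpa using hp, by simpa using hq⟩

/-- The subspace of the points satisfying `P`. -/
def sub (X : RepSpace.{u}) (P : X → Prop) : RepSpace.{u} where
  carrier := {x : X // P x}
  Names p x := X.Names p x.1
  unique h h' := Subtype.ext (X.unique h h')
  surj x := X.surj x.1

/-- The space `𝒪(X)` of open sets: `U` is identified with the `f ∈ 𝒞(X, 𝕊)` for which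
`U = f⁻¹{⊤}`. -/
def opens (X : RepSpace.{u}) : RepSpace.{u} where
  carrier := {U : Set X // ∃ r, IsFunName X sierp r (fun x => x ∈ U)}
  Names r U := IsFunName X sierp r (fun x => x ∈ U.1)
  unique h h' := Subtype.ext (h.unique h')
  surj U := U.2

/-- The space `𝒜(X)` of closed sets: `A` is identified with the `f ∈ 𝒞(X, 𝕊)` for which
`A = f⁻¹{⊥}`. -/
def closeds (X : RepSpace.{u}) : RepSpace.{u} where
  carrier := {A : Set X // ∃ r, IsFunName X sierp r (fun x => x ∉ A)}
  Names r A := IsFunName X sierp r (fun x => x ∉ A.1)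
  unique h h' := Subtype.ext (Set.ext fun x => not_iff_not.1 (iff_of_eq (congrFun (h.unique h') x)))
  surj A := A.2

/-- The saturation of a set: the intersection of all its open supersets. -/
def saturation (X : RepSpace.{u}) (K : Set X) : Set X :=
  {x | ∀ U : X.opens, K ⊆ U.1 → x ∈ U.1}

/-- The collection of the open supersets of `K`. -/
def openNhds (X : RepSpace.{u}) (K : Set X) : Set X.opens := {U | K ⊆ U.1}

/-- The space `𝒦(X)` of saturated compact sets, as a subspace of `𝒪(𝒪(X))`: a set `K` is compact
if `{U ∈ 𝒪(X) | K ⊆ U}` belongs to `𝒪(𝒪(X))`, and the names of `K` are those of this element. -/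
def compacts (X : RepSpace.{u}) : RepSpace.{u} where
  carrier := {K : Set X // X.saturation K = K ∧
    ∃ r, IsFunName X.opens sierp r (fun U => U ∈ X.openNhds K)}
  Names r K := IsFunName X.opens sierp r (fun U => U ∈ X.openNhds K.1)
  unique {_ K L} h h' := by
    have e : X.openNhds K.1 = X.openNhds L.1 := h.unique h'
    have e' : X.saturation K.1 = X.saturation L.1 := by
      ext x
      exact forall_congr' fun U => imp_congr_left (iff_of_eq (congrFun e U))
    exact Subtype.ext (K.2.1.symm.trans (e'.trans L.2.1))
  surj K := K.2.2

/-- The subspace of `𝒞(𝒪(Y), 𝒪(X))` of the maps of the form `U ↦ f⁻¹(U)` for some `f : X → Y`. -/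
def preimageMaps (X : RepSpace.{u}) (Y : RepSpace.{v}) : RepSpace.{max u v} :=
  (maps Y.opens X.opens).sub fun g => ∃ f : X → Y, ∀ U : Y.opens, (g.1 U).1 = f ⁻¹' U.1

end RepSpace

end

-- A compact set is accessible only through the question whether it lies in a given open set, and a
-- set has the same open supersets as its saturation (`saturation_subset_iff`). To compute a compact
-- set it therefore suffices to semidecide K ⊆ U uniformly in U (`IsComputable.toCompacts`). Each
-- operation then reduces to an equivalence: K ∩ A ⊆ U iff K ⊆ Aᶜ ∪ U; f[K] ⊆ U iff K ⊆ f⁻¹(U); K ×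
-- L ⊆ W iff K ⊆ {x | L ⊆ W_x}, where W_x is the section of W at x. The sets on the right are
-- computed by evaluation and currying (`isComputable_eval`, `IsComputable.curry`), together with
-- "or" and "and" on the Sierpiński space.
--
-- For unions, products and projections the result must moreover be saturated already. This holds
-- because saturation acts pointwise: a point of the saturation of K lies in every open
-- neighbourhood of some single point of K (`exists_specializes_of_mem_saturation`). That in turn
-- rests on openness being a local property, which is where arbitrary oracles are needed
-- (`exists_openName_of_forall_mem`).
--
-- The machine model is handled through `isComputable_iff`: a map is computable iff a primitive
-- recursive function on finite words turns prefixes of names into ever longer prefixes of names.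

universe w

open Filter Cantor
open Nat.Partrec (Code)

/-! ### Primitive recursive functions on prefixes of infinite sequences -/

namespace Cantor

@[simp] theorem length_take (p : Cantor) (k : ℕ) : (p.take k).length = k := by simp [take]

@[simp] theorem getElem_take (p : Cantor) (k i : ℕ) (h : i < (p.take k).length) :
    (p.take k)[i] = p i := by simp [take]

theorem take_take (p : Cantor) {j k : ℕ} (h : j ≤ k) : (p.take k).take j = p.take j := by
  apply List.ext_getElem
  · simpa using h
  · intro i _ _
    simp

theorem take_eq_take {p q : Cantor} {j k : ℕ} (h : p.take k = q.take k) (hj : j ≤ k) :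
    p.take j = q.take j := by
  rw [← take_take p hj, h, take_take q hj]

theorem eq_take_iff {l : List Bool} {q : Cantor} :
    l = q.take l.length ↔ ∀ i (h : i < l.length), l[i] = q i := by
  constructor
  · intro h i hi
    have := List.getElem_of_eq h hi
    simpa using this
  · intro h
    apply List.ext_getElem
    · simp
    · intro i h1 _
      simp [h i h1]

/-- The lists `a 0, a 1, …` are prefixes of `q` whose lengths tend to infinity. -/
def Approx (a : ℕ → List Bool) (q : Cantor) : Prop :=
  Tendsto (fun k => (a k).length) atTop atTop ∧ ∀ k, a k = q.take (a k).length

theorem approx_take (p : Cantor) : Approx p.take p := by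
  refine ⟨?_, fun k => by simp⟩
  simp only [length_take]
  exact tendsto_id

/-- The list transformer `T` maps the prefixes of `p` to prefixes of `q` of unbounded length. -/
def Tracks (T : List Bool → List Bool) (p q : Cantor) : Prop := Approx (fun k => T (p.take k)) q

/-- Each `a k` is itself the prefix of `p` of its own length, so `T (a k)` runs through values that
`Tracks` already controls. -/
theorem Approx.comp {a : ℕ → List Bool} {T : List Bool → List Bool} {p q : Cantor}
    (ha : Approx a p) (hT : Tracks T p q) : Approx (fun k => T (a k)) q := by
  have e : ∀ k, T (a k) = T (p.take (a k).length) := fun k => by rw [← ha.2 k]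
  refine ⟨?_, fun k => ?_⟩
  · simp only [e]
    exact hT.1.comp ha.1
  · simp only [e]
    exact hT.2 _

/-- The entries of even index. -/
def evens (l : List Bool) : List Bool :=
  (List.range ((l.length + 1) / 2)).map fun i => l.getD (2 * i) false

/-- The entries of odd index. -/
def odds (l : List Bool) : List Bool :=
  (List.range (l.length / 2)).map fun i => l.getD (2 * i + 1) false

/-- Alternate the entries of two lists. -/
def interleave (a b : List Bool) : List Bool :=
  (List.range (2 * min a.length b.length)).map fun i =>
    if i % 2 = 0 then a.getD (i / 2) false else b.getD (i / 2) false

/-- The part of a list after the first occurrence of `true`. -/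
def untag (l : List Bool) : List Bool := l.drop (l.findIdx id + 1)

theorem getD_take (p : Cantor) {k i : ℕ} (h : i < k) : (p.take k).getD i false = p i := by
  simp [take, h]

theorem evens_take (p : Cantor) (k : ℕ) : evens (p.take k) = p.fst.take ((k + 1) / 2) := by
  apply List.ext_getElem
  · simp [evens]
  · intro i h _
    simp only [evens, length_take, List.length_map, List.length_range] at h
    simp only [evens, List.getElem_map, List.getElem_range, getElem_take]
    rw [getD_take _ (by omega), fst]

theorem odds_take (p : Cantor) (k : ℕ) : odds (p.take k) = p.snd.take (k / 2) := by
  apply List.ext_getElem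
  · simp [odds]
  · intro i h _
    simp only [odds, length_take, List.length_map, List.length_range] at h
    simp only [odds, List.getElem_map, List.getElem_range, getElem_take]
    rw [getD_take _ (by omega), snd]

theorem interleave_take (p q : Cantor) (j k : ℕ) :
    interleave (p.take j) (q.take k) = (pair p q).take (2 * min j k) := by
  apply List.ext_getElem
  · simp [interleave]
  · intro i h _
    simp only [interleave, length_take, List.length_map, List.length_range] at h
    simp only [interleave, List.getElem_map, List.getElem_range, getElem_take, pair]
    rw [getD_take _ (by omega), getD_take _ (by omega)]

theorem tag_take (n : ℕ) (p : Cantor) (k : ℕ) :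
    List.replicate n false ++ true :: p.take k = (tag n p).take (n + 1 + k) := by
  apply List.ext_getElem
  · simp; omega
  · intro i h _
    simp only [getElem_take, tag]
    rw [List.getElem_append]
    simp only [List.length_replicate]
    split_ifs with h1 h2
    · simp
    · simp [h2]
    · obtain ⟨m, rfl⟩ : ∃ m, i = n + 1 + m := ⟨i - (n + 1), by omega⟩
      have e : n + 1 + m - n = m + 1 := by omega
      simp only [e, List.getElem_cons_succ, getElem_take]
      congr 1
      omega

theorem findIdx_tag_take {n k : ℕ} (p : Cantor) (h : n < k) :
    ((tag n p).take k).findIdx id = n := by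
  rw [List.findIdx_eq (by simpa using h)]
  refine ⟨by simp [tag], fun j hj => ?_⟩
  simp [tag, hj]

theorem untag_tag_take (n : ℕ) (p : Cantor) (k : ℕ) :
    untag ((tag n p).take k) = p.take (k - (n + 1)) := by
  rcases lt_or_ge n k with h | h
  · rw [untag, findIdx_tag_take p h]
    apply List.ext_getElem
    · simp
    · intro i h1 h2
      simp only [List.getElem_drop, getElem_take, tag]
      rw [if_neg (by omega), if_neg (by omega)]
      congr 1
      omega
  -- No 1 has been read yet: `findIdx` returns the length of the word, so nothing remains after
  -- dropping.
  · have : ((tag n p).take k).findIdx id = k := by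
      conv_rhs => rw [← length_take (tag n p) k]
      rw [List.findIdx_eq_length]
      intro x hx
      obtain ⟨i, hi, rfl⟩ := List.getElem_of_mem hx
      rw [length_take] at hi
      simp [tag, show i < n by omega]
    rw [untag, this, Nat.sub_eq_zero_of_le (by omega), List.drop_eq_nil_of_le (by simp)]
    rfl

theorem tracks_id (p : Cantor) : Tracks id p p := approx_take p

theorem tracks_evens (p : Cantor) : Tracks evens p p.fst := by
  refine ⟨?_, fun k => by simp [evens_take]⟩
  simp only [evens_take, length_take]
  exact tendsto_atTop.2 fun b => (eventually_ge_atTop (2 * b)).mono fun k hk => by omega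

theorem tracks_odds (p : Cantor) : Tracks odds p p.snd := by
  refine ⟨?_, fun k => by simp [odds_take]⟩
  simp only [odds_take, length_take]
  exact tendsto_atTop.2 fun b => (eventually_ge_atTop (2 * b)).mono fun k hk => by omega

theorem Approx.interleave {a b : ℕ → List Bool} {p q : Cantor} (ha : Approx a p)
    (hb : Approx b q) : Approx (fun k => Cantor.interleave (a k) (b k)) (pair p q) := by
  have e : ∀ k, Cantor.interleave (a k) (b k) =
      (pair p q).take (2 * min (a k).length (b k).length) := fun k => by
    conv_lhs => rw [ha.2 k, hb.2 k, interleave_take]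
  refine ⟨?_, fun k => by simp [e]⟩
  simp only [e, length_take]
  refine tendsto_atTop.2 fun N => ?_
  filter_upwards [tendsto_atTop.1 ha.1 N, tendsto_atTop.1 hb.1 N] with k h1 h2
  omega

theorem tracks_tag (n : ℕ) (p : Cantor) :
    Tracks (fun l => List.replicate n false ++ true :: l) p (tag n p) := by
  refine ⟨?_, fun k => by simp [tag_take]⟩
  simp only [tag_take, length_take]
  exact tendsto_atTop.2 fun b => (eventually_ge_atTop b).mono fun k hk => by omega

theorem tracks_untag (n : ℕ) (p : Cantor) : Tracks untag (tag n p) p := by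
  refine ⟨?_, fun k => by simp [untag_tag_take]⟩
  simp only [untag_tag_take, length_take]
  exact tendsto_atTop.2 fun b => (eventually_ge_atTop (b + (n + 1))).mono fun k hk => by omega

/-- The list transformer whose output number `n` is computed by `g` from the prefix of
length `n`. -/
def scan (g : List Bool → Bool) (l : List Bool) : List Bool :=
  (List.range l.length).map fun n => g (l.take n)

theorem tracks_scan (g : List Bool → Bool) (p : Cantor) :
    Tracks (scan g) p (fun n => g (p.take n)) := by
  refine ⟨by simp only [scan, List.length_map, List.length_range, length_take]; exact tendsto_id,
    fun k => ?_⟩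
  rw [eq_take_iff]
  intro i hi
  simp only [scan, List.length_map, List.length_range, length_take] at hi
  simp [scan, take_take p hi.le]

theorem primrec_evens : Primrec evens :=
  Primrec.list_map
    (Primrec.list_range.comp (Primrec.nat_div.comp
      (Primrec.succ.comp Primrec.list_length) (Primrec.const 2)))
    ((Primrec.list_getD false).comp Primrec.fst
      (Primrec.nat_mul.comp (Primrec.const 2) Primrec.snd))

theorem primrec_odds : Primrec odds :=
  Primrec.list_map
    (Primrec.list_range.comp (Primrec.nat_div.comp Primrec.list_length (Primrec.const 2)))
    ((Primrec.list_getD false).comp Primrec.fst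
      (Primrec.succ.comp (Primrec.nat_mul.comp (Primrec.const 2) Primrec.snd)))

theorem primrec_interleave : Primrec₂ interleave :=
  Primrec.list_map
    (Primrec.list_range.comp (Primrec.nat_mul.comp (Primrec.const 2)
      (Primrec.nat_min.comp (Primrec.list_length.comp Primrec.fst)
        (Primrec.list_length.comp Primrec.snd))))
    (Primrec.ite
      (Primrec.eq.comp (Primrec.nat_mod.comp Primrec.snd (Primrec.const 2)) (Primrec.const 0))
      ((Primrec.list_getD false).comp (Primrec.fst.comp Primrec.fst)
        (Primrec.nat_div.comp Primrec.snd (Primrec.const 2)))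
      ((Primrec.list_getD false).comp (Primrec.snd.comp Primrec.fst)
        (Primrec.nat_div.comp Primrec.snd (Primrec.const 2))))

theorem primrec_findIdx_id : Primrec fun l : List Bool => l.findIdx id :=
  Primrec.list_findIdx Primrec.id Primrec.snd

theorem primrec_untag : Primrec untag :=
  Primrec.list_drop.comp (Primrec.succ.comp primrec_findIdx_id) Primrec.id

theorem primrec_tag (n : ℕ) :
    Primrec fun l : List Bool => List.replicate n false ++ true :: l :=
  Primrec.list_append.comp (Primrec.const _)
    (Primrec.list_cons.comp (Primrec.const true) Primrec.id)

theorem primrec_scan {g : List Bool → Bool} (hg : Primrec g) : Primrec (scan g) :=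
  Primrec.list_map (Primrec.list_range.comp Primrec.list_length)
    (hg.comp (Primrec.list_take.comp Primrec.snd Primrec.fst))

end Cantor


/-! ### Machines versus primitive recursive functions on prefixes -/

/-- The first value produced by `h` at an argument below `k`. -/
def firstBelow (h : ℕ → Option ℕ) (k : ℕ) : Option ℕ := ((List.range k).filterMap h).head?

/-- The bounded and the unbounded search try the arguments in the same order, so a success of the
bounded one is the first success overall. -/
theorem mem_rfindOpt_of_firstBelow {h : ℕ → Option ℕ} {k v : ℕ} (hk : firstBelow h k = some v) :
    v ∈ Nat.rfindOpt h := by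
  induction k with
  | zero => simp [firstBelow] at hk
  | succ k ih =>
    cases e : firstBelow h k with
    | some w =>
      have : firstBelow h (k + 1) = some w := by
        simp only [firstBelow] at e ⊢
        rw [List.range_succ, List.filterMap_append, List.head?_append, e]
        rfl
      obtain rfl : w = v := by simpa [this] using hk
      exact ih e
    | none =>
      have e' : ∀ i < k, h i = none := by
        simpa [firstBelow, List.head?_eq_none_iff, List.filterMap_eq_nil_iff] using e
      simp only [firstBelow] at e hk
      rw [List.range_succ, List.filterMap_append, List.head?_append, e] at hk
      have hv : h k = some v := by
        cases hh : h k <;> simp_all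
      rw [Nat.rfindOpt, Part.mem_bind_iff]
      refine ⟨k, Nat.mem_rfind.2 ⟨by simp [hv], fun {m} hm => by simp [e' m hm]⟩, by simp [hv]⟩

theorem eventually_firstBelow {h : ℕ → Option ℕ} {v : ℕ} (hv : v ∈ Nat.rfindOpt h) :
    ∀ᶠ k in atTop, firstBelow h k = some v := by
  obtain ⟨n, hn⟩ := Nat.rfindOpt_spec hv
  filter_upwards [eventually_gt_atTop n] with k hk
  cases e : firstBelow h k with
  | none =>
    have : ∀ i < k, h i = none := by
      simpa [firstBelow, List.head?_eq_none_iff, List.filterMap_eq_nil_iff] using e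
    simp [this n hk] at hn
  | some w => rw [Part.mem_unique hv (mem_rfindOpt_of_firstBelow e)]

/-- The output symbol number `n` that the program `c` can produce from the prefix `l` in a search
bounded by the length of `l`. -/
def symbolOn (c : Code) (l : List Bool) (n : ℕ) : Option Bool :=
  (firstBelow (fun s => c.evaln s.unpair.2 (Encodable.encode (l.take s.unpair.1, n)))
    l.length).bind Encodable.decode

/-- The output that the program `c` can produce from the prefix `l` in a search bounded by the
length of `l`. -/
def outputOn (c : Code) (l : List Bool) : List Bool :=
  (List.range ((List.range l.length).findIdx fun n => (symbolOn c l n).isNone)).map fun n =>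
    -- The default is never used: all these positions precede the first missing symbol.
    (symbolOn c l n).getD false

@[simp] theorem outputOn_nil (c : Code) : outputOn c [] = [] := rfl

theorem primrec_symbolOn : Primrec fun a : (Code × List Bool) × ℕ => symbolOn a.1.1 a.1.2 a.2 := by
  refine Primrec.option_bind (Primrec.list_head?.comp (Primrec.listFilterMap
    (Primrec.list_range.comp (Primrec.list_length.comp (Primrec.snd.comp Primrec.fst))) ?_))
    (Primrec.decode.comp Primrec.snd)
  have hs : Primrec fun a : ((Code × List Bool) × ℕ) × ℕ => a.2.unpair :=
    Primrec.unpair.comp Primrec.snd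
  exact Code.primrec_evaln.comp (((Primrec.snd.comp hs).pair
    (Primrec.fst.comp (Primrec.fst.comp Primrec.fst))).pair
      (Primrec.encode.comp ((Primrec.list_take.comp (Primrec.fst.comp hs)
        (Primrec.snd.comp (Primrec.fst.comp Primrec.fst))).pair
          (Primrec.snd.comp Primrec.fst))))

theorem primrec_outputOn : Primrec₂ outputOn := by
  have hn : Primrec fun o : Option Bool => o.isNone :=
    (Primrec.not.comp Primrec.option_isSome).of_eq fun o => by cases o <;> rfl
  exact Primrec.list_map
    (Primrec.list_range.comp (Primrec.list_findIdx
      (Primrec.list_range.comp (Primrec.list_length.comp Primrec.snd))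
      (hn.comp primrec_symbolOn)))
    (Primrec.option_getD.comp primrec_symbolOn (Primrec.const false))

/-- Attempt `s` reads a prefix of length `s.unpair.1 ≤ s < k`, so truncating the tape at `k` does
not affect it. -/
theorem symbolOn_take (c : Code) (p : Cantor) (k n : ℕ) :
    symbolOn c (p.take k) n =
      (firstBelow (fun s => c.evaln s.unpair.2 (Encodable.encode (p.take s.unpair.1, n))) k).bind
        Encodable.decode := by
  simp only [symbolOn, length_take, firstBelow]
  congr 2
  apply List.filterMap_congr
  intro s hs
  rw [take_take p ((Nat.unpair_left_le s).trans (List.mem_range.1 hs).le)]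

theorem MachineComputes.eventually_symbolOn {c : Code} {p q : Cantor} (h : MachineComputes c p q)
    (n : ℕ) : ∀ᶠ k in atTop, symbolOn c (p.take k) n = some (q n) := by
  filter_upwards [eventually_firstBelow (h n)] with k hk
  rw [symbolOn_take, hk]
  simp

theorem MachineComputes.symbolOn_eq {c : Code} {p q : Cantor} (h : MachineComputes c p q)
    {k n : ℕ} {b : Bool} (hb : symbolOn c (p.take k) n = some b) : b = q n := by
  rw [symbolOn_take, Option.bind_eq_some_iff] at hb
  obtain ⟨v, hv, hb⟩ := hb
  have := Part.mem_unique (h n) (mem_rfindOpt_of_firstBelow hv)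
  subst this
  simpa using hb.symm

/-- Every symbol is eventually found, so the first missing position tends to infinity; a symbol
found by the bounded search is the one the machine writes. -/
theorem MachineComputes.tracks {c : Code} {p q : Cantor} (h : MachineComputes c p q) :
    Tracks (outputOn c) p q := by
  constructor
  · refine tendsto_atTop.2 fun N => ?_
    have : ∀ᶠ k in atTop, ∀ n ∈ Finset.range N, symbolOn c (p.take k) n = some (q n) :=
      (Finset.eventually_all _).2 fun n _ => h.eventually_symbolOn n
    filter_upwards [this, eventually_ge_atTop N] with k hk hN
    simp only [outputOn, List.length_map, List.length_range, length_take]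
    by_contra! hlt
    have h1 := List.findIdx_getElem (xs := List.range k)
      (p := fun n => (symbolOn c (p.take k) n).isNone) (w := by simpa using hlt.trans_le hN)
    rw [List.getElem_range, hk _ (Finset.mem_range.2 hlt)] at h1
    simp at h1
  · intro k
    rw [eq_take_iff]
    intro i hi
    simp only [outputOn, List.length_map, List.length_range] at hi
    have hi' := hi.trans_le List.findIdx_le_length
    have h1 := List.not_of_lt_findIdx hi
    rw [List.getElem_range] at h1
    simp only [outputOn, List.getElem_map, List.getElem_range]
    cases e : symbolOn c (p.take k) i with
    | none => simp [e] at h1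
    | some b => exact h.symbolOn_eq e

/-- The program looks up entry `n` of `T l` and diverges if `T l` is too short. Every attempt that
halts gives the right symbol, so it does not matter which one succeeds first. -/
theorem exists_machineComputes_of_primrec {T : List Bool → List Bool} (hT : Primrec T) :
    ∃ c, ∀ p q, Tracks T p q → MachineComputes c p q := by
  have hg : Primrec fun a : List Bool × ℕ => (T a.1)[a.2]? :=
    Primrec.list_getElem?.comp (hT.comp Primrec.fst) Primrec.snd
  have hp : Partrec fun a : List Bool × ℕ => ((T a.1)[a.2]? : Part Bool) := hg.to_comp.ofOption
  obtain ⟨c, hc⟩ := Code.exists_code.1 hp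
  have hc' : ∀ l n v, v ∈ c.eval (Encodable.encode ((l, n) : List Bool × ℕ)) ↔
      ∃ b, (T l)[n]? = some b ∧ Encodable.encode b = v := by
    intro l n v
    rw [hc]
    simp
  refine ⟨c, fun p q h n => ?_⟩
  have key : ∀ (s v : ℕ), v ∈ c.evaln s.unpair.2 (Encodable.encode (p.take s.unpair.1, n)) →
      v = Encodable.encode (q n) := by
    intro s v hv
    obtain ⟨b, hb, rfl⟩ := (hc' _ _ _).1 (Code.evaln_sound hv)
    obtain ⟨hn, rfl⟩ := List.getElem?_eq_some_iff.1 hb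
    rw [eq_take_iff.1 (h.2 _) n hn]
  obtain ⟨k, hk⟩ := (tendsto_atTop.1 h.1 (n + 1)).exists
  have hq : (T (p.take k))[n]? = some (q n) := by
    rw [List.getElem?_eq_getElem hk, eq_take_iff.1 (h.2 _) n hk]
  obtain ⟨t, ht⟩ := Code.evaln_complete.1 ((hc' _ _ _).2 ⟨_, hq, rfl⟩)
  have hd : (machineRun c p n).Dom :=
    Nat.rfindOpt_dom.2 ⟨Nat.pair k t, Encodable.encode (q n), by simpa using ht⟩
  obtain ⟨s, hs⟩ := Nat.rfindOpt_spec (Part.get_mem hd)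
  rw [← key s _ hs]
  exact Part.get_mem hd

/-! ### Computable maps: composition, pairing, currying, evaluation -/

namespace RepSpace

variable {X : RepSpace.{u}} {Y : RepSpace.{v}} {Z : RepSpace.{w}}

theorem isComputable_iff {f : X → Y} : IsComputable X Y f ↔
    ∃ T, Primrec T ∧ ∀ p x, X.Names p x → ∃ q, Tracks T p q ∧ Y.Names q (f x) := by
  constructor
  · rintro ⟨c, hc⟩
    refine ⟨outputOn c, primrec_outputOn.comp (Primrec.const c) Primrec.id, fun p x hp => ?_⟩
    obtain ⟨q, hq, hy⟩ := hc p x hp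
    exact ⟨q, hq.tracks, hy⟩
  · rintro ⟨T, hT, h⟩
    obtain ⟨c, hc⟩ := exists_machineComputes_of_primrec hT
    refine ⟨c, fun p x hp => ?_⟩
    obtain ⟨q, hq, hy⟩ := h p x hp
    exact ⟨q, hc p q hq, hy⟩

theorem IsComputable.comp {g : Y → Z} {f : X → Y} (hg : IsComputable Y Z g)
    (hf : IsComputable X Y f) : IsComputable X Z (fun x => g (f x)) := by
  obtain ⟨T, hT, h⟩ := isComputable_iff.1 hf
  obtain ⟨S, hS, k⟩ := isComputable_iff.1 hg
  refine isComputable_iff.2 ⟨fun l => S (T l), hS.comp hT, fun p x hp => ?_⟩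
  obtain ⟨q, hq, hy⟩ := h p x hp
  obtain ⟨r, hr, hz⟩ := k q _ hy
  exact ⟨r, hq.comp hr, hz⟩

/-- A map that leaves names unchanged is computable. -/
theorem isComputable_of_names {f : X → Y} (h : ∀ p x, X.Names p x → Y.Names p (f x)) :
    IsComputable X Y f :=
  isComputable_iff.2 ⟨id, Primrec.id, fun p x hp => ⟨p, tracks_id p, h p x hp⟩⟩

theorem isComputable_fst : IsComputable (X.prod Y) X Prod.fst :=
  isComputable_iff.2 ⟨evens, primrec_evens, fun p _ hp => ⟨p.fst, tracks_evens p, hp.1⟩⟩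

theorem isComputable_snd : IsComputable (X.prod Y) Y Prod.snd :=
  isComputable_iff.2 ⟨odds, primrec_odds, fun p _ hp => ⟨p.snd, tracks_odds p, hp.2⟩⟩

theorem IsComputable.fst {f : X → Y.prod Z} (hf : IsComputable X (Y.prod Z) f) :
    IsComputable X Y (fun x => (f x).1) := isComputable_fst.comp hf

theorem IsComputable.snd {f : X → Y.prod Z} (hf : IsComputable X (Y.prod Z) f) :
    IsComputable X Z (fun x => (f x).2) := isComputable_snd.comp hf

theorem IsComputable.prodMk {f : X → Y} {g : X → Z} (hf : IsComputable X Y f)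
    (hg : IsComputable X Z g) : IsComputable X (Y.prod Z) (fun x => (f x, g x)) := by
  obtain ⟨T, hT, h⟩ := isComputable_iff.1 hf
  obtain ⟨S, hS, k⟩ := isComputable_iff.1 hg
  refine isComputable_iff.2
    ⟨fun l => interleave (T l) (S l), primrec_interleave.comp hT hS, fun p x hp => ?_⟩
  obtain ⟨q, hq, hy⟩ := h p x hp
  obtain ⟨r, hr, hz⟩ := k p x hp
  refine ⟨pair q r, Approx.interleave hq hr, ?_, ?_⟩
  · simpa using hy
  · simpa using hz

/-- A machine for the uncurried map becomes a machine for `f x` by reading the name of `x` as its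
oracle; its index does not depend on `x`. -/
theorem IsComputable.exists_tag {f : X → Y → Z}
    (hf : IsComputable (X.prod Y) Z (fun z => f z.1 z.2)) :
    ∃ n, ∀ p x, X.Names p x → IsFunName Y Z (tag n p) (f x) := by
  obtain ⟨c, hc⟩ := hf
  refine ⟨Encodable.encode c, fun p x hp => ⟨_, p, rfl, fun q y hq => ?_⟩⟩
  rw [nthMachine, Denumerable.ofNat_encode]
  exact hc (pair p q) (x, y) ⟨by simpa using hp, by simpa using hq⟩

theorem IsComputable.exists_isFunName {f : X → Y → Z}
    (hf : IsComputable (X.prod Y) Z (fun z => f z.1 z.2)) (x : X) :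
    ∃ r, IsFunName Y Z r (f x) := by
  obtain ⟨n, hn⟩ := hf.exists_tag
  obtain ⟨p, hp⟩ := X.surj x
  exact ⟨_, hn p x hp⟩

theorem isComputable_of_exists_tag {f : X → Y}
    (hf : ∃ n, ∀ p x, X.Names p x → Y.Names (tag n p) (f x)) : IsComputable X Y f := by
  obtain ⟨n, hn⟩ := hf
  exact isComputable_iff.2 ⟨_, primrec_tag n, fun p x hp => ⟨_, tracks_tag n p, hn p x hp⟩⟩

theorem IsComputable.curry {f : X → Y → Z}
    (hf : IsComputable (X.prod Y) Z (fun z => f z.1 z.2)) :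
    IsComputable X (maps Y Z) (fun x => ⟨f x, hf.exists_isFunName x⟩) :=
  isComputable_of_exists_tag hf.exists_tag

/-- This is the universal machine: `outputOn` is primitive recursive in the code as well, so the
code can be read off the name of the function. -/
theorem isComputable_eval :
    IsComputable ((maps X Y).prod X) Y (fun z => z.1.1 z.2) := by
  refine isComputable_iff.2 ⟨fun l =>
    outputOn (nthMachine ((evens l).findIdx id)) (interleave (untag (evens l)) (odds l)),
    primrec_outputOn.comp ((Primrec.ofNat Code).comp (primrec_findIdx_id.comp primrec_evens))
      (primrec_interleave.comp (primrec_untag.comp primrec_evens) primrec_odds), fun p z hp => ?_⟩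
  obtain ⟨⟨n, o, ho, h⟩, hx⟩ := hp
  obtain ⟨q, hq, hy⟩ := h _ _ hx
  refine ⟨q, ?_, hy⟩
  have hl : Tracks (fun l => outputOn (nthMachine n) (interleave (untag (evens l)) (odds l))) p q := by
    refine Approx.comp (Approx.interleave (Approx.comp (tracks_evens p) ?_) (tracks_odds p))
      hq.tracks
    rw [ho]
    exact tracks_untag n o
  -- Before the 1 of the tag has been read, the guessed machine index may be wrong; but then the
  -- simulated tape is empty, and every machine outputs the empty word on it.
  have e : ∀ k, outputOn (nthMachine ((evens (p.take k)).findIdx id))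
        (interleave (untag (evens (p.take k))) (odds (p.take k))) =
      outputOn (nthMachine n) (interleave (untag (evens (p.take k))) (odds (p.take k))) := by
    intro k
    rw [evens_take, ho]
    rcases lt_or_ge n ((k + 1) / 2) with hn | hn
    · rw [findIdx_tag_take o hn]
    · rw [untag_tag_take, Nat.sub_eq_zero_of_le (by omega)]
      simp [interleave, Cantor.take]
  simpa only [Tracks, e] using hl

theorem IsComputable.eval {f : X → maps Y Z} {g : X → Y} (hf : IsComputable X (maps Y Z) f)
    (hg : IsComputable X Y g) : IsComputable X Z (fun x => (f x).1 (g x)) :=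
  isComputable_eval.comp (hf.prodMk hg)

/-! ### Truth values -/

/-- Whether the list contains `true`. -/
def hasTrue (l : List Bool) : Bool := decide (l.findIdx id < l.length)

theorem hasTrue_iff {l : List Bool} : hasTrue l = true ↔ ∃ i, ∃ h : i < l.length, l[i] = true := by
  simp [hasTrue, List.findIdx_lt_length, List.mem_iff_getElem]

theorem primrec_hasTrue : Primrec hasTrue :=
  (Primrec.nat_lt.comp primrec_findIdx_id Primrec.list_length).decide

theorem Approx.exists_hasTrue {a : ℕ → List Bool} {p : Cantor} (h : Approx a p) :
    (∃ k, hasTrue (a k) = true) ↔ ∃ n, p n = true := by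
  simp only [hasTrue_iff]
  constructor
  · rintro ⟨k, i, hi, e⟩
    exact ⟨i, by rw [← eq_take_iff.1 (h.2 k) i hi, e]⟩
  · rintro ⟨n, hn⟩
    obtain ⟨k, hk⟩ := (tendsto_atTop.1 h.1 (n + 1)).exists
    exact ⟨k, n, hk, by rw [eq_take_iff.1 (h.2 k) n hk, hn]⟩

theorem Approx.eventually_hasTrue {a : ℕ → List Bool} {p : Cantor} (h : Approx a p)
    (hp : ∃ n, p n = true) : ∀ᶠ k in atTop, hasTrue (a k) = true := by
  obtain ⟨n, hn⟩ := hp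
  filter_upwards [tendsto_atTop.1 h.1 (n + 1)] with k hk
  exact hasTrue_iff.2 ⟨n, hk, by rw [eq_take_iff.1 (h.2 k) n hk, hn]⟩

/-- A predicate is semidecidable if it can be decided by waiting for a test on the prefixes of the
names to succeed. -/
theorem isComputable_sierp_of_scan {P : X → Prop} {g : List Bool → Bool} (hg : Primrec g)
    (h : ∀ p x, X.Names p x → (P x ↔ ∃ k, g (p.take k) = true)) : IsComputable X sierp P :=
  isComputable_iff.2
    ⟨scan g, primrec_scan hg, fun p x hp => ⟨_, tracks_scan g p, h p x hp⟩⟩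

theorem isComputable_or :
    IsComputable (sierp.prod sierp) sierp (fun z : Prop × Prop => z.1 ∨ z.2) := by
  refine isComputable_sierp_of_scan primrec_hasTrue fun p z hp => ?_
  rw [Approx.exists_hasTrue (approx_take p)]
  obtain ⟨h1, h2⟩ := hp
  constructor
  · rintro (h | h)
    · obtain ⟨n, hn⟩ := h1.1 h
      exact ⟨_, hn⟩
    · obtain ⟨n, hn⟩ := h2.1 h
      exact ⟨_, hn⟩
  · rintro ⟨n, hn⟩
    rcases Nat.even_or_odd' n with ⟨m, rfl | rfl⟩
    · exact Or.inl (h1.2 ⟨m, hn⟩)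
    · exact Or.inr (h2.2 ⟨m, hn⟩)

theorem isComputable_and :
    IsComputable (sierp.prod sierp) sierp (fun z : Prop × Prop => z.1 ∧ z.2) := by
  refine isComputable_sierp_of_scan (g := fun l => hasTrue (evens l) && hasTrue (odds l))
    (Primrec.and.comp (primrec_hasTrue.comp primrec_evens) (primrec_hasTrue.comp primrec_odds))
    fun p z hp => ?_
  obtain ⟨h1, h2⟩ := hp
  have e1 : z.1 ↔ _ := h1
  have e2 : z.2 ↔ _ := h2
  simp only [Bool.and_eq_true]
  constructor
  · rintro ⟨h, h'⟩
    -- Both tests stay true from some prefix on, hence succeed on a common one.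
    exact ((Approx.eventually_hasTrue (tracks_evens p) (e1.1 h)).and
      (Approx.eventually_hasTrue (tracks_odds p) (e2.1 h'))).exists
  · rintro ⟨k, h, h'⟩
    exact ⟨e1.2 ((Approx.exists_hasTrue (tracks_evens p)).1 ⟨k, h⟩),
      e2.2 ((Approx.exists_hasTrue (tracks_odds p)).1 ⟨k, h'⟩)⟩

theorem IsComputable.or {P Q : X → Prop} (hP : IsComputable X sierp P)
    (hQ : IsComputable X sierp Q) : IsComputable X sierp (fun x => P x ∨ Q x) :=
  isComputable_or.comp (hP.prodMk hQ)

theorem IsComputable.and {P Q : X → Prop} (hP : IsComputable X sierp P)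
    (hQ : IsComputable X sierp Q) : IsComputable X sierp (fun x => P x ∧ Q x) :=
  isComputable_and.comp (hP.prodMk hQ)

/-! ### Open, closed and compact sets -/

/-- Names of an open set are names of its characteristic map, so membership is evaluation. The next
two lemmas use the same identification. -/
theorem IsComputable.mem_open {f : X → Y} {U : X → Y.opens} (hf : IsComputable X Y f)
    (hU : IsComputable X Y.opens U) : IsComputable X sierp (fun x => f x ∈ (U x).1) := by
  have h : IsComputable Y.opens (Y.maps sierp) (fun U => ⟨fun y => y ∈ U.1, U.2⟩) :=
    isComputable_of_names fun _ _ h => h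
  exact (h.comp hU).eval hf

theorem IsComputable.notMem_closed {f : X → Y} {A : X → Y.closeds} (hf : IsComputable X Y f)
    (hA : IsComputable X Y.closeds A) : IsComputable X sierp (fun x => f x ∉ (A x).1) := by
  have h : IsComputable Y.closeds (Y.maps sierp) (fun A => ⟨fun y => y ∉ A.1, A.2⟩) :=
    isComputable_of_names fun _ _ h => h
  exact (h.comp hA).eval hf

theorem IsComputable.subset_open {K : X → Y.compacts} {U : X → Y.opens}
    (hK : IsComputable X Y.compacts K) (hU : IsComputable X Y.opens U) :
    IsComputable X sierp (fun x => (K x).1 ⊆ (U x).1) := by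
  have h : IsComputable Y.compacts (Y.opens.maps sierp) (fun K => ⟨fun U => K.1 ⊆ U.1, K.2.2⟩) :=
    isComputable_of_names fun _ _ h => h
  exact (h.comp hK).eval hU

theorem IsComputable.exists_openName {U : X → Set Y}
    (hU : IsComputable (X.prod Y) sierp (fun z => z.2 ∈ U z.1)) (x : X) :
    ∃ r, IsFunName Y sierp r (fun y => y ∈ U x) :=
  IsComputable.exists_isFunName (Z := sierp) (f := fun x y => y ∈ U x) hU x

theorem IsComputable.toOpens {U : X → Set Y}
    (hU : IsComputable (X.prod Y) sierp (fun z => z.2 ∈ U z.1)) :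
    IsComputable X Y.opens (fun x => ⟨U x, hU.exists_openName x⟩) :=
  isComputable_of_exists_tag (IsComputable.exists_tag (Z := sierp) (f := fun x y => y ∈ U x) hU)

theorem subset_saturation (K : Set X) : K ⊆ X.saturation K := fun _ h _ hU => hU h

theorem saturation_subset_iff {K : Set X} {U : X.opens} : X.saturation K ⊆ U.1 ↔ K ⊆ U.1 :=
  ⟨(subset_saturation K).trans, fun h _ hx => hx U h⟩

theorem saturation_congr {K L : Set X} (h : ∀ U : X.opens, K ⊆ U.1 ↔ L ⊆ U.1) :
    X.saturation K = X.saturation L :=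
  Set.ext fun _ => forall_congr' fun U => imp_congr_left (h U)

theorem saturation_saturation (K : Set X) : X.saturation (X.saturation K) = X.saturation K :=
  saturation_congr fun _ => saturation_subset_iff

theorem IsComputable.saturation_isCompact {K : X → Set Y}
    (hK : IsComputable (X.prod Y.opens) sierp (fun z => K z.1 ⊆ z.2.1)) (x : X) :
    Y.saturation (Y.saturation (K x)) = Y.saturation (K x) ∧
      ∃ r, IsFunName Y.opens sierp r (fun U => U ∈ Y.openNhds (Y.saturation (K x))) := by
  refine ⟨saturation_saturation _, ?_⟩
  simp only [openNhds, Set.mem_ofPred_eq, saturation_subset_iff]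
  exact IsComputable.exists_isFunName (Z := sierp) (f := fun x (U : Y.opens) => K x ⊆ U.1) hK x

/-- The criterion behind all compact-valued operations whose result is built from points: the
saturation can be ignored when testing containment in open sets. -/
theorem IsComputable.toCompacts {K : X → Set Y}
    (hK : IsComputable (X.prod Y.opens) sierp (fun z => K z.1 ⊆ z.2.1)) :
    IsComputable X Y.compacts (fun x => ⟨Y.saturation (K x), hK.saturation_isCompact x⟩) := by
  refine isComputable_of_exists_tag ?_
  simp only [compacts, openNhds, Set.mem_ofPred_eq, saturation_subset_iff]
  exact IsComputable.exists_tag (Z := sierp) (f := fun x (U : Y.opens) => K x ⊆ U.1) hK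

/-- A set that is a neighbourhood of each of its points is open. -/
theorem exists_openName_of_forall_mem {V : Set X}
    (hV : ∀ x ∈ V, ∃ U : X.opens, x ∈ U.1 ∧ U.1 ⊆ V) :
    ∃ r, IsFunName X sierp r (fun x => x ∈ V) := by
  classical
  -- The oracle lists, by their codes, the finite words all of whose extensions name only points of
  -- `V`.
  let o : Cantor := fun e => decide (∃ l : List Bool, Encodable.encode l = e ∧
    ∀ p x, p.take l.length = l → X.Names p x → x ∈ V)
  have ho : ∀ l, o (Encodable.encode l) = true ↔
      ∀ p x, p.take l.length = l → X.Names p x → x ∈ V := by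
    intro l
    simp only [o, decide_eq_true_eq]
    constructor
    · rintro ⟨l', e, h⟩
      rwa [← Encodable.encode_injective e]
    · exact fun h => ⟨l, rfl, h⟩
  -- A one-point space whose only name is `o` turns computability relative to `o` into plain
  -- computability on a product.
  let O : RepSpace.{0} :=
    { carrier := Unit
      Names := fun p _ => p = o
      unique := fun _ _ => rfl
      surj := fun _ => ⟨o, rfl⟩ }
  have key : IsComputable (O.prod X) sierp (fun z => z.2 ∈ V) := by
    -- The test looks for a prefix of the name listed by the oracle; oracle entries not yet read
    -- count as "not listed".
    refine isComputable_sierp_of_scan (g := fun l => hasTrue ((List.range (odds l).length).map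
      fun k => (evens l).getD (Encodable.encode ((odds l).take k)) false)) ?_ fun p z hp => ?_
    · exact primrec_hasTrue.comp (Primrec.list_map
        (Primrec.list_range.comp (Primrec.list_length.comp primrec_odds))
        ((Primrec.list_getD false).comp (primrec_evens.comp Primrec.fst)
          (Primrec.encode.comp (Primrec.list_take.comp Primrec.snd
            (primrec_odds.comp Primrec.fst)))))
    obtain ⟨hpo, hx⟩ := hp
    have hpo : p.fst = o := hpo
    simp only [hasTrue_iff, evens_take, odds_take, hpo, length_take, List.length_map,
      List.length_range, List.getElem_map, List.getElem_range]
    constructor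
    · intro hz
      obtain ⟨U, hzU, hUV⟩ := hV _ hz
      obtain ⟨r, hr⟩ := U.2
      obtain ⟨n, o', rfl, hr⟩ := hr
      obtain ⟨q, hq, hs⟩ := hr _ _ hx
      obtain ⟨m, hm⟩ := (Approx.exists_hasTrue hq.tracks).2 (hs.1 hzU)
      -- The machine for `U` accepts after reading `m` symbols of its tape. A name sharing `m`
      -- symbols with the given one yields a tape sharing `2 * m` symbols, so its point is accepted
      -- too and lies in `U ⊆ V`.
      have hm' : o (Encodable.encode (p.snd.take m)) = true := by
        rw [ho]
        intro p' x' e hx'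
        obtain ⟨q', hq', hs'⟩ := hr _ _ hx'
        refine hUV (hs'.2 ((Approx.exists_hasTrue hq'.tracks).1 ⟨m, ?_⟩))
        rw [length_take] at e
        rwa [take_eq_take (k := 2 * m) (q := pair o' p.snd) _ (by omega)]
        rw [show 2 * m = 2 * min m m by simp, ← interleave_take, e, interleave_take]
      -- About half of the `k` symbols belong to the oracle and half to the name; both halves must
      -- reach far enough.
      obtain ⟨k, hk⟩ := exists_gt (2 * (m + Encodable.encode (p.snd.take m)) + 2)
      refine ⟨k, m, by omega, ?_⟩
      rw [take_take _ (by omega), getD_take _ (by omega), hm']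
    · rintro ⟨k, m, hm, h⟩
      rw [take_take _ hm.le] at h
      have : o (Encodable.encode (p.snd.take m)) = true := by
        by_cases hlt : Encodable.encode (p.snd.take m) < (k + 1) / 2
        · rwa [getD_take _ hlt] at h
        · rw [List.getD_eq_default _ _ (by simpa using hlt)] at h
          cases h
      exact (ho _).1 this p.snd z.2 (by simp) hx
  exact IsComputable.exists_isFunName (Z := sierp) (f := fun (_ : O) (x : X) => x ∈ V) key ()

/-- A point of the saturation of `K` belongs to all open neighbourhoods of some point of `K`. -/
theorem exists_specializes_of_mem_saturation {K : Set X} {x : X} (hx : x ∈ X.saturation K) :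
    ∃ a ∈ K, ∀ U : X.opens, a ∈ U.1 → x ∈ U.1 := by
  by_contra! h
  -- The points having an open neighbourhood that misses `x` form an open set. If it contained all
  -- of `K`, it would contain `x`, which is absurd.
  have hV := exists_openName_of_forall_mem (X := X) (V := {a | ∃ U : X.opens, a ∈ U.1 ∧ x ∉ U.1})
    fun a ⟨U, ha, hU⟩ => ⟨U, ha, fun b hb => ⟨U, hb, hU⟩⟩
  obtain ⟨U, hU, hxU⟩ := hx ⟨_, hV⟩ h
  exact hxU hU

theorem mem_of_specializes {K : X.compacts} {a x : X} (ha : a ∈ K.1)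
    (h : ∀ U : X.opens, a ∈ U.1 → x ∈ U.1) : x ∈ K.1 := by
  rw [← K.2.1]
  exact fun U hU => h U (hU ha)

/-! ### The individual operations on compact sets -/

theorem isComputable_saturation_singleton :
    IsComputable (X.prod X.opens) sierp (fun z => {z.1} ⊆ z.2.1) := by
  simp only [Set.singleton_subset_iff]
  exact isComputable_fst.mem_open isComputable_snd

theorem isComputable_union_compacts :
    IsComputable ((X.compacts.prod X.compacts).prod X.opens) sierp
      (fun z => z.1.1.1 ∪ z.1.2.1 ⊆ z.2.1) := by
  simp only [Set.union_subset_iff]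
  exact (isComputable_fst.fst.subset_open isComputable_snd).and
    (isComputable_fst.snd.subset_open isComputable_snd)

theorem saturation_union_compacts (K L : X.compacts) :
    X.saturation (K.1 ∪ L.1) = K.1 ∪ L.1 := by
  refine subset_antisymm (fun x hx => ?_) (subset_saturation _)
  obtain ⟨a, ha | ha, h⟩ := exists_specializes_of_mem_saturation hx
  · exact Or.inl (mem_of_specializes ha h)
  · exact Or.inr (mem_of_specializes ha h)

theorem isComputable_inter_closed :
    IsComputable ((X.compacts.prod X.closeds).prod X.opens) sierp
      (fun z => z.1.1.1 ∩ z.1.2.1 ⊆ z.2.1) := by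
  have h : IsComputable (((X.compacts.prod X.closeds).prod X.opens).prod X) sierp
      (fun z => z.2 ∈ {x | x ∉ z.1.1.2.1 ∨ x ∈ z.1.2.1}) :=
    (isComputable_snd.notMem_closed isComputable_fst.fst.snd).or
      (isComputable_snd.mem_open isComputable_fst.snd)
  have e : (fun z : ((X.compacts.prod X.closeds).prod X.opens) =>
      (z.1.1.1 ∩ z.1.2.1 ⊆ z.2.1 : sierp)) =
      fun z => z.1.1.1 ⊆ {x | x ∉ z.1.2.1 ∨ x ∈ z.2.1} := by
    funext z
    refine propext (forall_congr' fun x => ?_)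
    simp only [Set.mem_inter_iff, Set.mem_ofPred_eq]
    tauto
  rw [e]
  exact isComputable_fst.fst.subset_open h.toOpens

theorem isComputable_preimage_open :
    IsComputable (((X.maps Y).prod Y.opens).prod X) sierp
      (fun z => z.2 ∈ z.1.1.1 ⁻¹' z.1.2.1) :=
  (isComputable_fst.fst.eval isComputable_snd).mem_open isComputable_fst.snd

theorem isComputable_image_compact :
    IsComputable (((X.maps Y).prod X.compacts).prod Y.opens) sierp
      (fun z => z.1.1.1 '' z.1.2.1 ⊆ z.2.1) := by
  simp only [Set.image_subset_iff]
  exact isComputable_fst.snd.subset_open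
    ((IsComputable.toOpens (X := (X.maps Y).prod Y.opens) (U := fun z => z.1.1 ⁻¹' z.2.1)
      isComputable_preimage_open).comp (isComputable_fst.fst.prodMk isComputable_snd))

/-- The saturated image of a compact set. -/
def imageCompact (f : X.maps Y) (K : X.compacts) : Y.compacts :=
  ⟨Y.saturation (f.1 '' K.1), IsComputable.saturation_isCompact
    (X := (X.maps Y).prod X.compacts) (K := fun z => z.1.1 '' z.2.1)
    isComputable_image_compact (f, K)⟩

theorem isComputable_imageCompact :
    IsComputable ((X.maps Y).prod X.compacts) Y.compacts (fun z => imageCompact z.1 z.2) :=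
  IsComputable.toCompacts (X := (X.maps Y).prod X.compacts) (K := fun z => z.1.1 '' z.2.1)
    isComputable_image_compact

/-- A function whose preimage map is the given one. -/
noncomputable def preimageMaps.fn (g : X.preimageMaps Y) : X → Y := g.2.choose

theorem preimageMaps.preimage_fn (g : X.preimageMaps Y) (U : Y.opens) :
    (g.1.1 U).1 = preimageMaps.fn g ⁻¹' U.1 := g.2.choose_spec U

/-- Containment of the image in an open set only involves the preimage map, so the noncomputable
choice of `preimageMaps.fn` does no harm. -/
theorem isComputable_image_compact_of_preimage :
    IsComputable (((X.preimageMaps Y).prod X.compacts).prod Y.opens) sierp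
      (fun z => preimageMaps.fn z.1.1 '' z.1.2.1 ⊆ z.2.1) := by
  simp only [Set.image_subset_iff, ← preimageMaps.preimage_fn]
  have h : IsComputable (X.preimageMaps Y) (Y.opens.maps X.opens) (fun g => g.1) :=
    isComputable_of_names fun _ _ h => h
  exact isComputable_fst.snd.subset_open ((h.comp isComputable_fst.fst).eval isComputable_snd)

/-- The saturated image of a compact set, from the preimage map. -/
def preimageMaps.imageCompact (g : X.preimageMaps Y) (K : X.compacts) : Y.compacts :=
  ⟨Y.saturation (preimageMaps.fn g '' K.1), IsComputable.saturation_isCompact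
    (X := (X.preimageMaps Y).prod X.compacts) (K := fun z => preimageMaps.fn z.1 '' z.2.1)
    isComputable_image_compact_of_preimage (g, K)⟩

theorem preimageMaps.isComputable_imageCompact :
    IsComputable ((X.preimageMaps Y).prod X.compacts) Y.compacts
      (fun z => preimageMaps.imageCompact z.1 z.2) :=
  IsComputable.toCompacts (X := (X.preimageMaps Y).prod X.compacts)
    (K := fun z => preimageMaps.fn z.1 '' z.2.1) isComputable_image_compact_of_preimage

theorem isComputable_section :
    IsComputable (((X.prod Y).opens.prod X).prod Y) sierp
      (fun z => z.2 ∈ {y | (z.1.2, y) ∈ z.1.1.1}) :=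
  (isComputable_fst.snd.prodMk isComputable_snd).mem_open isComputable_fst.fst

theorem isComputable_section_swap :
    IsComputable (((X.prod Y).opens.prod Y).prod X) sierp
      (fun z => z.2 ∈ {x | (x, z.1.2) ∈ z.1.1.1}) :=
  (isComputable_snd.prodMk isComputable_fst.snd).mem_open isComputable_fst.fst

/-- Compactness is used twice: that of the second factor makes {x | L ⊆ W_x} open, that of the first
tests whether this set contains K. -/
theorem isComputable_prod_compacts :
    IsComputable ((X.compacts.prod Y.compacts).prod (X.prod Y).opens) sierp
      (fun z => z.1.1.1 ×ˢ z.1.2.1 ⊆ z.2.1) := by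
  have h : IsComputable (((X.compacts.prod Y.compacts).prod (X.prod Y).opens).prod X) sierp
      (fun z => z.2 ∈ {x | z.1.1.2.1 ⊆ {y | (x, y) ∈ z.1.2.1}}) :=
    isComputable_fst.fst.snd.subset_open
      ((IsComputable.toOpens (X := (X.prod Y).opens.prod X)
        (U := fun z => {y | (z.2, y) ∈ z.1.1}) isComputable_section).comp
        (isComputable_fst.snd.prodMk isComputable_snd))
  have e : (fun z : (X.compacts.prod Y.compacts).prod (X.prod Y).opens =>
      (z.1.1.1 ×ˢ z.1.2.1 ⊆ z.2.1 : sierp)) =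
      fun z => z.1.1.1 ⊆ {x | z.1.2.1 ⊆ {y | (x, y) ∈ z.2.1}} :=
    funext fun z => propext Set.prod_subset_iff
  rw [e]
  exact isComputable_fst.fst.subset_open h.toOpens

/-- Cylinders over open sets are open, which gives one direction. For the other, sections of open
sets are open, so the coordinates can be replaced one at a time; no base of open rectangles is
needed. -/
theorem specializes_prod_iff {a x : X} {b y : Y} :
    (∀ W : (X.prod Y).opens, (a, b) ∈ W.1 → (x, y) ∈ W.1) ↔
      (∀ U : X.opens, a ∈ U.1 → x ∈ U.1) ∧ ∀ V : Y.opens, b ∈ V.1 → y ∈ V.1 := by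
  constructor
  · intro h
    constructor
    · intro U ha
      have hU : IsComputable (X.opens.prod (X.prod Y)) sierp
          (fun z => z.2 ∈ {w : X.prod Y | w.1 ∈ z.1.1}) :=
        isComputable_snd.fst.mem_open isComputable_fst
      exact h ⟨{w | w.1 ∈ U.1}, hU.exists_openName
        (U := fun U : X.opens => {w : X.prod Y | w.1 ∈ U.1}) U⟩ ha
    · intro V hb
      have hV : IsComputable (Y.opens.prod (X.prod Y)) sierp
          (fun z => z.2 ∈ {w : X.prod Y | w.2 ∈ z.1.1}) :=
        isComputable_snd.snd.mem_open isComputable_fst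
      exact h ⟨{w | w.2 ∈ V.1}, hV.exists_openName
        (U := fun V : Y.opens => {w : X.prod Y | w.2 ∈ V.1}) V⟩ hb
  · rintro ⟨hx, hy⟩ W hab
    have h1 : (x, b) ∈ W.1 := hx ⟨{x | (x, b) ∈ W.1}, isComputable_section_swap.exists_openName
      (X := (X.prod Y).opens.prod Y) (U := fun z => {x | (x, z.2) ∈ z.1.1}) (W, b)⟩ hab
    exact hy ⟨{y | (x, y) ∈ W.1}, isComputable_section.exists_openName
      (X := (X.prod Y).opens.prod X) (U := fun z => {y | (z.2, y) ∈ z.1.1}) (W, x)⟩ h1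

theorem saturation_prod_compacts (K : X.compacts) (L : Y.compacts) :
    (X.prod Y).saturation (K.1 ×ˢ L.1) = K.1 ×ˢ L.1 := by
  refine subset_antisymm (fun z hz => ?_) (subset_saturation _)
  obtain ⟨c, hc, h⟩ := exists_specializes_of_mem_saturation hz
  have h := specializes_prod_iff.1 h
  exact ⟨mem_of_specializes hc.1 h.1, mem_of_specializes hc.2 h.2⟩

/-- Moving only the first coordinate of a point of `K` stays inside `K`, because `K` is saturated.
-/
theorem saturation_fst_image (K : (X.prod Y).compacts) :
    X.saturation (Prod.fst '' K.1) = Prod.fst '' K.1 := by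
  refine subset_antisymm (fun x hx => ?_) (subset_saturation _)
  obtain ⟨_, ⟨c, hc, rfl⟩, h⟩ := exists_specializes_of_mem_saturation hx
  exact ⟨(x, c.2), mem_of_specializes hc (specializes_prod_iff.2 ⟨h, fun _ h => h⟩), rfl⟩

theorem saturation_snd_image (K : (X.prod Y).compacts) :
    Y.saturation (Prod.snd '' K.1) = Prod.snd '' K.1 := by
  refine subset_antisymm (fun y hy => ?_) (subset_saturation _)
  obtain ⟨_, ⟨c, hc, rfl⟩, h⟩ := exists_specializes_of_mem_saturation hy
  exact ⟨(c.1, y), mem_of_specializes hc (specializes_prod_iff.2 ⟨fun _ h => h, h⟩), rfl⟩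

/-- The image of compact sets under a computable function is computable. -/
theorem IsComputable.image_subset_open {f : X → Y} (hf : IsComputable X Y f) :
    IsComputable (X.compacts.prod Y.opens) sierp (fun z => f '' z.1.1 ⊆ z.2.1) := by
  have h : IsComputable ((X.compacts.prod Y.opens).prod X) sierp
      (fun z => z.2 ∈ f ⁻¹' z.1.2.1) :=
    (hf.comp isComputable_snd).mem_open isComputable_fst.snd
  simp only [Set.image_subset_iff]
  exact isComputable_fst.subset_open h.toOpens

end RepSpace

open RepSpace

theorem proposition11 (X : RepSpace.{u}) (Y : RepSpace.{v}) :
    -- containment of a compact set in an open set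
    (RepSpace.IsComputable (X.compacts.prod X.opens) RepSpace.sierp
      (fun z => z.1.1 ⊆ z.2.1)) ∧
    -- saturation of a point
    (∃ F : X → X.compacts, (∀ x, (F x).1 = X.saturation {x}) ∧
      RepSpace.IsComputable X X.compacts F) ∧
    -- binary union
    (∃ F : X.compacts × X.compacts → X.compacts, (∀ K L, (F (K, L)).1 = K.1 ∪ L.1) ∧
      RepSpace.IsComputable (X.compacts.prod X.compacts) X.compacts F) ∧
    -- intersection with a closed set
    (∃ F : X.compacts × X.closeds → X.compacts,
      (∀ K A, (F (K, A)).1 = X.saturation (K.1 ∩ A.1)) ∧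
      RepSpace.IsComputable (X.compacts.prod X.closeds) X.compacts F) ∧
    -- from the preimage map on open sets to the image map on compact sets
    (∃ F : X.preimageMaps Y → X.compacts.maps Y.compacts,
      (∀ (g : X.preimageMaps Y) (f : X → Y), (∀ U : Y.opens, (g.1.1 U).1 = f ⁻¹' U.1) →
        ∀ K : X.compacts, ((F g).1 K).1 = Y.saturation (f '' K.1)) ∧
      RepSpace.IsComputable (X.preimageMaps Y) (X.compacts.maps Y.compacts) F) ∧
    -- from a continuous map to the image map on compact sets
    (∃ F : X.maps Y → X.compacts.maps Y.compacts,
      (∀ (f : X.maps Y) (K : X.compacts), ((F f).1 K).1 = Y.saturation (f.1 '' K.1)) ∧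
      RepSpace.IsComputable (X.maps Y) (X.compacts.maps Y.compacts) F) ∧
    -- image of a compact set under a continuous map
    (∃ F : X.maps Y × X.compacts → Y.compacts,
      (∀ f K, (F (f, K)).1 = Y.saturation (f.1 '' K.1)) ∧
      RepSpace.IsComputable ((X.maps Y).prod X.compacts) Y.compacts F) ∧
    -- product
    (∃ F : X.compacts × Y.compacts → (X.prod Y).compacts,
      (∀ K L, (F (K, L)).1 = K.1 ×ˢ L.1) ∧
      RepSpace.IsComputable (X.compacts.prod Y.compacts) (X.prod Y).compacts F) ∧
    -- projections
    (∃ F : (X.prod Y).compacts → X.compacts, (∀ K, (F K).1 = Prod.fst '' K.1) ∧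
      RepSpace.IsComputable (X.prod Y).compacts X.compacts F) ∧
    (∃ F : (X.prod Y).compacts → Y.compacts, (∀ K, (F K).1 = Prod.snd '' K.1) ∧
      RepSpace.IsComputable (X.prod Y).compacts Y.compacts F) := by
  refine ⟨isComputable_fst.subset_open isComputable_snd,
    ⟨_, fun x => ?_, IsComputable.toCompacts (K := fun x => {x}) isComputable_saturation_singleton⟩,
    ⟨_, fun K L => ?_, IsComputable.toCompacts (X := X.compacts.prod X.compacts)
      (K := fun z => z.1.1 ∪ z.2.1) isComputable_union_compacts⟩,
    ⟨_, fun K A => ?_, IsComputable.toCompacts (X := X.compacts.prod X.closeds)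
      (K := fun z => z.1.1 ∩ z.2.1) isComputable_inter_closed⟩,
    ⟨_, fun g f hgf K => ?_, preimageMaps.isComputable_imageCompact.curry⟩,
    ⟨_, fun f K => ?_, isComputable_imageCompact.curry⟩,
    ⟨_, fun f K => ?_, isComputable_imageCompact⟩,
    ⟨_, fun K L => ?_, IsComputable.toCompacts (X := X.compacts.prod Y.compacts)
      (K := fun z => z.1.1 ×ˢ z.2.1) isComputable_prod_compacts⟩,
    ⟨_, fun K => ?_, IsComputable.toCompacts (X := (X.prod Y).compacts)
      (K := fun K => Prod.fst '' K.1) isComputable_fst.image_subset_open⟩,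
    ⟨_, fun K => ?_, IsComputable.toCompacts (X := (X.prod Y).compacts)
      (K := fun K => Prod.snd '' K.1) isComputable_snd.image_subset_open⟩⟩
  · rfl
  · exact saturation_union_compacts K L
  · rfl
  -- The chosen function and `f` have the same preimages of open sets, so their images of `K` have
  -- the same open supersets.
  · refine saturation_congr fun U => ?_
    rw [Set.image_subset_iff, Set.image_subset_iff, ← preimageMaps.preimage_fn g U, hgf U]
  · rfl
  · rfl
  · exact saturation_prod_compacts K L
  · exact saturation_fst_image K
  · exact saturation_snd_image K
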